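/- Throughout, $X$ is a standard Borel space, $\mathcal R$ is a Borel equivalence relation on $X$ with countable classes, and graphs have oriented edges: every edge $e$ has an origin $o(e)$, a terminus $t(e)$ and an opposite edge $\bar e\neq e$. A Borel equivalence relation always means one with countable classes, on a standard Borel space. *Actions.* An $\mathcal R$-action on a standard Borel space $F$ with a countable-to-one Borel map $\pi:F\to X$ is a Borel map $((x,y),t)\mapsto (x,y)\cdot t$, defined for $(x,y)\in\mathcal R$ and $\pi(t)=y$, such that $\pi((x,y)\cdot t)=x$, $(z,z)\cdot t=t$ and $(x,y)\cdot((y,z)\cdot t)=(x,z)\cdot t$. Its orbit equivalence relation is denoted $\mathcal R_F$, and saturations in $F$ are taken with respect to $\mathcal R_F$. The stabilizer $\mathrm{Stab}(s)$ of a partial section $s:B\to F$ is the relation on $B$ given by $x\sim y\iff s(x)\mathrel{\mathcal R_F}s(y)$. An $\mathcal R$-arboretum $\mathcal A$ is a graph whose vertex space $\mathcal A^0$ and edge space $\mathcal A^1$ carry $\mathcal R$-actions, whose maps $o,t,\bar{\ }$ are Borel, fibre-preserving and equivariant, and whose fibre over each $x\in X$ is a tree. *Graphs of relations.* An oriented graph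 of relations consists of a countable oriented graph $G$, a Borel equivalence relation on a standard Borel space for each vertex and each edge (the same one for $a$ and $\bar a$), and, for each edge $a$, an injective Borel morphism $\iota_a$ from the relation carried by $a$ into the one carried by $t(a)$. Each edge $a$ then carries a partial isomorphism $\iota_{\bar a}(w)\mapsto\iota_a(w)$ from a subset of the space of $o(a)$ onto a subset of the space of $t(a)$. *Desingularizations.* A desingularization of the action of $\mathcal R$ on an $\mathcal R$-arboretum $\mathcal A$ consists of the following data. 1. An oriented graph of relations with underlying graph $G$, and a maximal subtree $A_m$ of $G$ containing all its vertices, with a root vertex. Let $\mathcal S$ be the equivalence relation generated on the disjoint union of the vertex spaces by the partial isomorphisms carried by the edges of $A_m$. The space $Y$ of the root is required to be a fundamental domain of $\mathcal S$, and it is identified with $X$ by a Borel isomorphism. 2. An injective Borel morphism of graphs $\chi$ into $\mathcal A$, from the graph whose vertices (respectively edges) are the points of the spaces carried by the vertices (respectively the edges) of $A_m$. It sends a vertex that is $\mathcal S$-equivalent to $y\in Y$ into the fibre over the point of $X$ identified with $y$. For each vertex and edge of $A_m$, $\chi$ is an isomorphism from the relation it carries onto the restriction of $\mathcal R_{\mathcal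 A^0}$, respectively $\mathcal R_{\mathcal A^1}$, to the image (the *representation*) of its space. The saturations of the representations of the vertex spaces are pairwise disjoint and cover $\mathcal A^0$. 3. For each positively oriented edge $a$ outside $A_m$, a Borel isomorphism $\varphi_a$ between Borel subsets of $X$ with graph contained in $\mathcal R$, and a Borel partial section of edges $s_a$ defined on the source of $\varphi_a$. For $x$ in this source, $o(s_a(x))$ lies in the representation of the space of $o(a)$, and $(\varphi_a(x),x)\cdot t(s_a(x))$ lies in the representation of the space of $t(a)$. Identifying $x$ with $o(s_a(x))$, the relation $\mathrm{Stab}(s_a)$ is the image by $\chi\circ\iota_{\bar a}$ of the relation carried by $a$. Identifying $\varphi_a(x)$ with $(\varphi_a(x),x)\cdot t(s_a(x))$, the relation $\varphi_a\,\mathrm{Stab}(s_a)\,\varphi_a^{-1}$ is the image by $\chi\circ\iota_a$ of the relation carried by $a$. 4. The representation of the space of such an edge $a$ is the image of $s_a$, and that of $\bar a$ is the set of opposite edges. The saturations of the representations of the spaces of all oriented edges of $G$ are pairwise disjoint and cover $\mathcal A^1$. For a vertex $P$ of $G$, let $\mathcal R_P$ be the relation carried by $P$, transported to a subset of $X$ by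 $\chi$ followed by the projection to $X$. For a positive edge $a$ outside $A_m$ put $\varphi_{\bar a}=\varphi_a^{-1}$; for an edge $a$ of $A_m$ let $\varphi_a$ be the identity of the projection to $X$ of the representation of the space of $o(a)$. Let $\mathcal R'$ be the equivalence relation on $X$ generated by all the $\mathcal R_P$, and $\mathcal R''$ the equivalence relation on $X$ generated by all the $\varphi_a$, for $a$ an edge of $G$ (it is trivial outside the domains of the $\varphi_a$). **Proposition 40.** For every desingularization of the action of $\mathcal R$ on an $\mathcal R$-arboretum, $\mathcal R'$ and $\mathcal R''$ are Borel subrelations of $\mathcal R$, and $\mathcal R$ is generated by $\mathcal R'$ and $\mathcal R''$: it is the smallest equivalence relation containing both. Moreover $\mathcal R''$ is treeable, that is, there is an acyclic Borel graph on $X$ whose connected components are the classes of $\mathcal R''$; and for every vertex $P$ of $G$ the intersection of $\mathcal R_P$ with $\mathcal R''$ is trivial: if $x\mathrel{\mathcal R_P}y$ and $x\mathrel{\mathcal R''}y$, then $x=y$. -/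

import Mathlib

/-- An equivalence relation on a measurable space is a *countable Borel equivalence relation* if
it is a measurable subset of the square and all its classes are countable. -/
structure IsCountableBorel {X : Type*} [MeasurableSpace X] (R : Setoid X) : Prop where
  measurableSet : MeasurableSet {p : X × X | R p.1 p.2}
  countable_class : ∀ x, {y | R x y}.Countable

/-! ### Graphs with oriented edges, and trees -/

/-- A graph in the sense of Serre: every (oriented) edge `e` has an origin, a terminus, and an
opposite edge `bar e ≠ e`. -/
structure SerreGraph (V E : Type*) where
  org : E → V
  ter : E → V
  bar : E → E
  bar_bar : ∀ e, bar (bar e) = e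
  bar_ne : ∀ e, bar e ≠ e
  org_bar : ∀ e, org (bar e) = ter e

namespace SerreGraph

/-- The list `l` of edges is a walk from `u` to `v`. -/
def IsWalk {V E : Type*} (G : SerreGraph V E) : V → List E → V → Prop
  | u, [], v => u = v
  | u, e :: l, v => G.org e = u ∧ G.IsWalk (G.ter e) l v

/-- The list `l` has no backtracking: no edge is followed by its opposite. -/
def IsReduced {V E : Type*} (G : SerreGraph V E) (l : List E) : Prop :=
  l.IsChain fun e f => f ≠ G.bar e

/-- The vertex set `S` and the edge set `T` form a subgraph which is a tree: it is nonempty,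
connected, and contains no circuit (closed walk of positive length without backtracking). -/
structure IsTreeOn {V E : Type*} (G : SerreGraph V E) (S : Set V) (T : Set E) : Prop where
  bar_mem : ∀ e ∈ T, G.bar e ∈ T
  org_mem : ∀ e ∈ T, G.org e ∈ S
  nonempty : S.Nonempty
  connected : ∀ u ∈ S, ∀ v ∈ S, ∃ l : List E, (∀ e ∈ l, e ∈ T) ∧ G.IsWalk u l v
  no_circuit : ∀ (u : V) (l : List E), (∀ e ∈ l, e ∈ T) → G.IsWalk u l u → G.IsReduced l → l = []

/-- The graph with an orientation given by the maps `o, t` on its set `E` of positive edges: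
`(a, true)` is the positive edge `a`, and `(a, false)` is its opposite. -/
def ofOriented {V E : Type*} (o t : E → V) : SerreGraph V (E × Bool) where
  org e := if e.2 then o e.1 else t e.1
  ter e := if e.2 then t e.1 else o e.1
  bar e := (e.1, !e.2)
  bar_bar e := by simp
  bar_ne e h := by
    have := congrArg Prod.snd h
    simp at this
  org_bar e := by cases h : e.2 <;> simp

end SerreGraph

/-! ### Actions of an equivalence relation on fibred spaces and on fields of graphs -/

/-- A standard fibred space `proj : F → X` with countable fibres, with a (left) Borel action of `R`.
The element `(x, y) · t` is `act x y t`; it is meaningful only when `R x y` and `t` lies over `y`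
(the values of `act` elsewhere are irrelevant). Empty fibres are allowed, because a tree may have
no edges. -/
structure FibredAction {X : Type*} [MeasurableSpace X] (R : Setoid X)
    (F : Type*) [MeasurableSpace F] where
  proj : F → X
  measurable_proj : Measurable proj
  countable_fibre : ∀ x, {t | proj t = x}.Countable
  act : X → X → F → F
  measurable_act : Measurable
    fun q : {q : (X × X) × F // R q.1.1 q.1.2 ∧ proj q.2 = q.1.2} => act q.1.1.1 q.1.1.2 q.1.2
  proj_act : ∀ x y t, R x y → proj t = y → proj (act x y t) = x
  act_self : ∀ z t, proj t = z → act z z t = t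
  act_act : ∀ x y z t, R x y → R y z → proj t = z → act x y (act y z t) = act x z t

namespace FibredAction

/-- The equivalence relation `R_F` on `F` whose classes are the orbits of the action. -/
def orbitRel {X : Type*} [MeasurableSpace X] {R : Setoid X} {F : Type*} [MeasurableSpace F]
    (A : FibredAction R F) : Setoid F where
  r f g := R (A.proj f) (A.proj g) ∧ A.act (A.proj f) (A.proj g) g = f
  iseqv :=
    { refl := fun f => ⟨R.refl _, A.act_self _ _ rfl⟩
      symm := by
        rintro f g ⟨h, e⟩
        refine ⟨R.symm h, ?_⟩
        conv_lhs => rw [← e]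
        rw [A.proj_act _ _ _ h rfl, A.act_act _ _ _ _ (R.symm h) h rfl, A.act_self _ _ rfl]
      trans := by
        rintro f g k ⟨h, e⟩ ⟨h', e'⟩
        refine ⟨R.trans h h', ?_⟩
        rw [← A.act_act _ _ _ _ h h' rfl, e', e] }

/-- The saturation of a subset of `F` under the action. -/
def saturation {X : Type*} [MeasurableSpace X] {R : Setoid X} {F : Type*} [MeasurableSpace F]
    (A : FibredAction R F) (B : Set F) : Set F :=
  {f | ∃ g ∈ B, A.orbitRel f g}

/-- The stabilizer of a partial section `s : B → F`, an equivalence relation on `B`. -/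
def stab {X : Type*} [MeasurableSpace X] {R : Setoid X} {F : Type*} [MeasurableSpace F]
    (A : FibredAction R F) {B : Set X} (s : B → F) : Setoid B :=
  Setoid.comap s A.orbitRel

end FibredAction

/-- A Borel field of graphs on `X` with an action of `R`: the spaces `V` of vertices and `E` of
edges are fibred over `X` and carry actions of `R`, and the structure maps are Borel and
equivariant and preserve the fibres. -/
structure GraphField {X : Type*} [MeasurableSpace X] (R : Setoid X)
    (V E : Type*) [MeasurableSpace V] [MeasurableSpace E] extends SerreGraph V E where
  vert : FibredAction R V
  edge : FibredAction R E
  measurable_org : Measurable org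
  measurable_ter : Measurable ter
  measurable_bar : Measurable bar
  proj_org : ∀ e, vert.proj (org e) = edge.proj e
  proj_ter : ∀ e, vert.proj (ter e) = edge.proj e
  proj_bar : ∀ e, edge.proj (bar e) = edge.proj e
  org_act : ∀ x y e, R x y → edge.proj e = y → org (edge.act x y e) = vert.act x y (org e)
  ter_act : ∀ x y e, R x y → edge.proj e = y → ter (edge.act x y e) = vert.act x y (ter e)
  bar_act : ∀ x y e, R x y → edge.proj e = y → bar (edge.act x y e) = edge.act x y (bar e)

/-- The field of graphs is an arboretum: the fibre over each point is a tree. -/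
def GraphField.IsArboretum {X : Type*} [MeasurableSpace X] {R : Setoid X}
    {V E : Type*} [MeasurableSpace V] [MeasurableSpace E] (A : GraphField R V E) : Prop :=
  ∀ x, A.IsTreeOn {v | A.vert.proj v = x} {e | A.edge.proj e = x}

/-- An element of the full pseudogroup `[[R]]`: a Borel isomorphism between Borel subsets of `X`
whose graph is contained in `R`. -/
structure FullPseudogroup {X : Type*} [MeasurableSpace X] (R : Setoid X)
    extends PartialEquiv X X where
  measurableSet_source : MeasurableSet source
  measurableSet_target : MeasurableSet target
  measurable_toFun : Measurable (source.domRestrict toFun)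
  measurable_invFun : Measurable (target.domRestrict invFun)
  rel : ∀ x ∈ source, R x (toFun x)

/-! ### Graphs of relations -/

/-- An oriented graph of relations. The underlying graph is countable, with an orientation: `Edge`
is the set of positive edges. A vertex `P` carries the countable Borel equivalence relation `vRel P`
on the standard Borel space `VSp P`; a positive edge `a` and its opposite both carry the relation
`eRel a` on `ESp a`. The injective morphism attached to `a` is `injT a` and the one attached to
the opposite of `a`, whose terminus is `org a`, is `injO a`. -/
structure RelGraph where
  Vert : Type*
  Edge : Type*
  countable_vert : Countable Vert
  countable_edge : Countable Edge
  org : Edge → Vert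
  ter : Edge → Vert
  VSp : Vert → Type*
  ESp : Edge → Type*
  instMV : ∀ P, MeasurableSpace (VSp P)
  instME : ∀ a, MeasurableSpace (ESp a)
  standardV : ∀ P, StandardBorelSpace (VSp P)
  standardE : ∀ a, StandardBorelSpace (ESp a)
  vRel : ∀ P, Setoid (VSp P)
  eRel : ∀ a, Setoid (ESp a)
  vRel_borel : ∀ P, IsCountableBorel (vRel P)
  eRel_borel : ∀ a, IsCountableBorel (eRel a)
  injO : ∀ a, ESp a → VSp (org a)
  injT : ∀ a, ESp a → VSp (ter a)
  measurable_injO : ∀ a, Measurable (injO a)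
  measurable_injT : ∀ a, Measurable (injT a)
  injective_injO : ∀ a, Function.Injective (injO a)
  injective_injT : ∀ a, Function.Injective (injT a)
  injO_rel : ∀ a w w', eRel a w w' → vRel (org a) (injO a w) (injO a w')
  injT_rel : ∀ a w w', eRel a w w' → vRel (ter a) (injT a w) (injT a w')

attribute [instance] RelGraph.countable_vert RelGraph.countable_edge RelGraph.instMV
  RelGraph.instME RelGraph.standardV RelGraph.standardE

namespace RelGraph

/-- The underlying graph. -/
def graph (G : RelGraph) : SerreGraph G.Vert (G.Edge × Bool) :=
  SerreGraph.ofOriented G.org G.ter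

/-- The disjoint union of the spaces carried by the vertices. -/
abbrev VTotal (G : RelGraph) : Type _ := Σ P : G.Vert, G.VSp P

/-- The disjoint union of the spaces carried by the positive edges in `M`. -/
abbrev ETotal (G : RelGraph) (M : Set G.Edge) : Type _ := Σ a : M, G.ESp a

/-- The graph on `G.VTotal` whose edges are the points of the spaces carried by the edges in `M`
and by their opposites: a point `w` of `G.ESp a` joins `injO a w` to `injT a w`. When `M` spans a
rooted tree this is the total space of the arboretum over the space of the root which is defined by
the partial isomorphisms carried by the edges. -/
def totalGraph (G : RelGraph) (M : Set G.Edge) : SerreGraph G.VTotal (G.ETotal M × Bool) :=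
  SerreGraph.ofOriented (fun w => ⟨G.org w.1, G.injO w.1 w.2⟩) (fun w => ⟨G.ter w.1, G.injT w.1 w.2⟩)

/-- The equivalence relation on the disjoint union of the vertex spaces generated by the partial
isomorphisms `injO a w ↦ injT a w` carried by the edges in `M`. -/
def gluing (G : RelGraph) (M : Set G.Edge) : Setoid G.VTotal :=
  Relation.EqvGen.setoid fun q q' => ∃ w : G.ETotal M,
    q = ⟨G.org w.1, G.injO w.1 w.2⟩ ∧ q' = ⟨G.ter w.1, G.injT w.1 w.2⟩

end RelGraph

/-! ### Arboretums of representatives and desingularizations -/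

/-- An arboretum of representatives of the action of `R` on `A`, given by a rooted maximal subtree of
`G` (that is, one which contains all the vertices) whose root carries a space identified with `X`. -/
structure Representatives {X : Type*} [MeasurableSpace X] {R : Setoid X}
    {V E : Type*} [MeasurableSpace V] [MeasurableSpace E]
    (A : GraphField R V E) (G : RelGraph) where
  /-- The positive edges of the maximal subtree. -/
  tree : Set G.Edge
  isTree : G.graph.IsTreeOn Set.univ {e | e.1 ∈ tree}
  root : G.Vert
  /-- The space carried by the root is a fundamental domain of the gluing relation. -/
  rooted : ∀ q : G.VTotal, ∃! r : G.VSp root, G.gluing tree q ⟨root, r⟩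
  /-- The identification of the space carried by the root with `X`. -/
  base : G.VSp root ≃ᵐ X
  /-- The representation on vertices and on edges: an isomorphism onto a subfield of `A`. -/
  χV : G.VTotal → V
  χE : G.ETotal tree × Bool → E
  measurable_χV : Measurable χV
  measurable_χE : Measurable χE
  injective_χV : Function.Injective χV
  injective_χE : Function.Injective χE
  χ_org : ∀ e, A.org (χE e) = χV ((G.totalGraph tree).org e)
  χ_ter : ∀ e, A.ter (χE e) = χV ((G.totalGraph tree).ter e)
  χ_bar : ∀ e, A.bar (χE e) = χE ((G.totalGraph tree).bar e)
  /-- The representation is fibred over the identification `base`. -/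
  proj_χV : ∀ q r, G.gluing tree q ⟨root, r⟩ → A.vert.proj (χV q) = base r
  /-- The relations carried by the vertices and by the edges of the tree are isomorphic, by the
  representation, to the restrictions of the orbit relations. -/
  vRel_iff : ∀ P (y y' : G.VSp P), G.vRel P y y' ↔ A.vert.orbitRel (χV ⟨P, y⟩) (χV ⟨P, y'⟩)
  eRel_iff : ∀ (a : tree) (w w' : G.ESp a) (b : Bool),
    G.eRel a w w' ↔ A.edge.orbitRel (χE (⟨a, w⟩, b)) (χE (⟨a, w'⟩, b))
  /-- The saturations of the representations of the vertex spaces form a partition. -/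
  vertex_cover : ⋃ P, A.vert.saturation (Set.range fun y : G.VSp P => χV ⟨P, y⟩) = Set.univ
  vertex_disjoint : Pairwise fun P Q =>
    Disjoint (A.vert.saturation (Set.range fun y : G.VSp P => χV ⟨P, y⟩))
      (A.vert.saturation (Set.range fun y : G.VSp Q => χV ⟨Q, y⟩))

/-- For injective maps `f : W → F` and `g : B → F`, the images in `F` of the relation `r` on `W` and
of the relation `s` on `B` are the same relation on the same subset of `F`. -/
def SameImage {W B F : Type*} (f : W → F) (r : Setoid W) (g : B → F) (s : Setoid B) : Prop :=
  Set.range f = Set.range g ∧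
    ∀ w w' x x', f w = g x → f w' = g x' → (r w w' ↔ s x x')

/-- An arboretum of representatives, with a partial isomorphism in `[[R]]` and a Borel partial section
of edges, defined on its source, for each positive edge outside the maximal subtree. -/
structure DesingularizationData {X : Type*} [MeasurableSpace X] {R : Setoid X}
    {V E : Type*} [MeasurableSpace V] [MeasurableSpace E]
    (A : GraphField R V E) (G : RelGraph) extends Representatives A G where
  φ : ∀ a : G.Edge, a ∉ tree → FullPseudogroup R
  sec : ∀ (a : G.Edge) (ha : a ∉ tree), (φ a ha).source → E
  measurable_sec : ∀ a ha, Measurable (sec a ha)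
  proj_sec : ∀ a ha x, A.edge.proj (sec a ha x) = x

namespace DesingularizationData

/-- The inverse of `φ a`, from its target to its source. -/
def inv {X : Type*} [MeasurableSpace X] {R : Setoid X}
    {V E : Type*} [MeasurableSpace V] [MeasurableSpace E]
    {A : GraphField R V E} {G : RelGraph} (D : DesingularizationData A G)
    (a : G.Edge) (ha : a ∉ D.tree) (z : (D.φ a ha).target) : (D.φ a ha).source :=
  ⟨(D.φ a ha).invFun z, (D.φ a ha).map_target' z.2⟩

/-- The terminus of the section attached to `a`, moved by `φ a`: over the point `z = φ a x` of the
target it is the vertex `(z, x) · ter (sec a x)`. -/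
def movedTer {X : Type*} [MeasurableSpace X] {R : Setoid X}
    {V E : Type*} [MeasurableSpace V] [MeasurableSpace E]
    {A : GraphField R V E} {G : RelGraph} (D : DesingularizationData A G)
    (a : G.Edge) (ha : a ∉ D.tree) (z : (D.φ a ha).target) : V :=
  A.vert.act z (D.inv a ha z) (A.ter (D.sec a ha (D.inv a ha z)))

/-- The representation in `E` of the space carried by an oriented edge: for a positive edge `a`
outside the tree it is the image of `sec a`, and for its opposite the set of the opposite edges. -/
def edgeRep {X : Type*} [MeasurableSpace X] {R : Setoid X}
    {V E : Type*} [MeasurableSpace V] [MeasurableSpace E]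
    {A : GraphField R V E} {G : RelGraph} (D : DesingularizationData A G)
    (e : G.Edge × Bool) : Set E :=
  {ε | (∃ (h : e.1 ∈ D.tree) (w : G.ESp e.1), ε = D.χE (⟨⟨e.1, h⟩, w⟩, e.2)) ∨
    ∃ (h : e.1 ∉ D.tree) (x : (D.φ e.1 h).source),
      ε = if e.2 then D.sec e.1 h x else A.bar (D.sec e.1 h x)}

end DesingularizationData

/-- A desingularization of the action of `R` on `A`, with underlying oriented graph of relations
`G`. -/
structure Desingularization {X : Type*} [MeasurableSpace X] {R : Setoid X}
    {V E : Type*} [MeasurableSpace V] [MeasurableSpace E]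
    (A : GraphField R V E) (G : RelGraph) extends DesingularizationData A G where
  /-- The origins of the section attached to `a` lie in the representation of the space of `org a`,
  and the termini, moved by `φ a`, lie in the representation of the space of `ter a`. -/
  org_sec_mem : ∀ a ha x, A.org (sec a ha x) ∈ Set.range fun y : G.VSp (G.org a) => χV ⟨G.org a, y⟩
  ter_sec_mem : ∀ a ha z, toDesingularizationData.movedTer a ha z ∈
    Set.range fun y : G.VSp (G.ter a) => χV ⟨G.ter a, y⟩
  /-- The representation carries the image in `vRel (org a)` of the relation carried by `a` to the
  stabilizer of the section, read on the origins of the section. -/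
  stab_org : ∀ a ha, SameImage (fun w : G.ESp a => χV ⟨G.org a, G.injO a w⟩) (G.eRel a)
    (fun x => A.org (sec a ha x)) (A.edge.stab (sec a ha))
  /-- The representation carries the image in `vRel (ter a)` of the relation carried by `a` to the
  stabilizer of the section conjugated by `φ a`, read on the moved termini of the section. -/
  stab_ter : ∀ a ha, SameImage (fun w : G.ESp a => χV ⟨G.ter a, G.injT a w⟩) (G.eRel a)
    (toDesingularizationData.movedTer a ha)
    (Setoid.comap (toDesingularizationData.inv a ha) (A.edge.stab (sec a ha)))
  /-- The saturations of the representations of the spaces carried by the oriented edges form a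
  partition. -/
  edge_cover : ⋃ e, A.edge.saturation (toDesingularizationData.edgeRep e) = Set.univ
  edge_disjoint : Pairwise fun e e' =>
    Disjoint (A.edge.saturation (toDesingularizationData.edgeRep e))
      (A.edge.saturation (toDesingularizationData.edgeRep e'))

namespace Desingularization

/-- The relation carried by the vertex `P`, identified by the representation with a relation on a
subset of `X`. -/
def vertexRel {X : Type*} [MeasurableSpace X] {R : Setoid X}
    {V E : Type*} [MeasurableSpace V] [MeasurableSpace E]
    {A : GraphField R V E} {G : RelGraph} (D : Desingularization A G)
    (P : G.Vert) (x x' : X) : Prop :=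
  ∃ y y' : G.VSp P, G.vRel P y y' ∧
    A.vert.proj (D.χV ⟨P, y⟩) = x ∧ A.vert.proj (D.χV ⟨P, y'⟩) = x'

/-- The graph of the partial isomorphism of `X` carried by an oriented edge: for an edge of the
tree it is the identity on the projection to `X` of the representation of the space carried by
its origin, for a positive edge `a` outside the tree it is `φ a`, and for its opposite it is the
inverse of `φ a`. -/
def edgeIso {X : Type*} [MeasurableSpace X] {R : Setoid X}
    {V E : Type*} [MeasurableSpace V] [MeasurableSpace E]
    {A : GraphField R V E} {G : RelGraph} (D : Desingularization A G)
    (e : G.Edge × Bool) (x x' : X) : Prop :=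
  (e.1 ∈ D.tree ∧ x = x' ∧ ∃ y : G.VSp (G.graph.org e), A.vert.proj (D.χV ⟨G.graph.org e, y⟩) = x) ∨
    ∃ h : e.1 ∉ D.tree,
      if e.2 then x ∈ (D.φ e.1 h).source ∧ (D.φ e.1 h).toFun x = x'
      else x ∈ (D.φ e.1 h).target ∧ (D.φ e.1 h).invFun x = x'

/-- The relation `R'` on `X` generated by the relations carried by the vertices. -/
def vertexPart {X : Type*} [MeasurableSpace X] {R : Setoid X}
    {V E : Type*} [MeasurableSpace V] [MeasurableSpace E]
    {A : GraphField R V E} {G : RelGraph} (D : Desingularization A G) : Setoid X :=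
  Relation.EqvGen.setoid fun x x' => ∃ P, D.vertexRel P x x'

/-- The relation `R''` on `X` generated by the partial isomorphisms carried by the edges. -/
def edgePart {X : Type*} [MeasurableSpace X] {R : Setoid X}
    {V E : Type*} [MeasurableSpace V] [MeasurableSpace E]
    {A : GraphField R V E} {G : RelGraph} (D : Desingularization A G) : Setoid X :=
  Relation.EqvGen.setoid fun x x' => ∃ e, D.edgeIso e x x'

end Desingularization

/-- An equivalence relation is treeable if it has a treeing: a Borel graph on `X` without
cycles whose connected components are the classes of the relation. -/
def IsTreeable {X : Type*} [MeasurableSpace X] (R : Setoid X) : Prop :=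
  ∃ Γ : SimpleGraph X, MeasurableSet {p : X × X | Γ.Adj p.1 p.2} ∧ Γ.IsAcyclic ∧
    ∀ x y, R x y ↔ Γ.Reachable x y

/-!
The translates of the tree of representatives over a point `y` of `X` are the components of the
forest spanned in the arboretum by the translates of the edges of the maximal subtree. Two points
of `X` index the same component exactly when the relations carried by the vertices of the graph of
relations identify them, and every other edge of the arboretum joins two components in the way one
of the partial isomorphisms `φ a` joins two points of `X`. Connectedness of the fibres therefore
shows that `R` is generated by `R'` and `R''`. Conversely, a trail in the graph of the `φ a` lifts
to a reduced walk in a fibre which leaves a component whenever it enters one, so a nonempty trail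
cannot join two points indexing the same component: the graph is acyclic and `R''` meets every
`R_P` trivially. As for measurability, geodesics in an acyclic graph are unique, so in a Borel
acyclic graph the pairs at bounded distance form an injective image of a Borel set.
-/

/-! ### Borel graphs -/

theorem measurableSet_fromRel_adj {α : Type*} [MeasurableSpace α] {r : α → α → Prop}
    (hr : MeasurableSet {p : α × α | p.1 ≠ p.2 ∧ r p.1 p.2}) :
    MeasurableSet {p : α × α | (SimpleGraph.fromRel r).Adj p.1 p.2} := by
  convert hr.union (measurable_swap hr) using 1
  ext p
  simp only [SimpleGraph.fromRel_adj, Set.mem_ofPred_eq, Set.mem_union, Set.mem_preimage,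
    Prod.fst_swap, Prod.snd_swap, ne_comm (a := p.2), and_or_left]

theorem eqvGen_setoid_eq_reachableSetoid_fromRel {α : Type*} (r : α → α → Prop) :
    Relation.EqvGen.setoid r = (SimpleGraph.fromRel r).reachableSetoid := by
  refine le_antisymm (Setoid.eqvGen_le fun x y h => ?_) fun x y h => ?_
  · rcases eq_or_ne x y with rfl | hne
    · exact SimpleGraph.Reachable.refl _
    · exact ((SimpleGraph.fromRel_adj r x y).2 ⟨hne, .inl h⟩).reachable
  · obtain ⟨p⟩ : (SimpleGraph.fromRel r).Reachable x y := h
    induction p with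
    | nil => exact .refl _
    | cons hadj _ ih =>
      obtain ⟨-, h | h⟩ := (SimpleGraph.fromRel_adj r _ _).1 hadj
      exacts [.trans _ _ _ (.rel _ _ h) ih, .trans _ _ _ (.symm _ _ (.rel _ _ h)) ih]

section BorelAcyclic

variable {X : Type*} {Γ : SimpleGraph X}

theorem edist_le_succ_iff {x y : X} {n : ℕ} :
    Γ.edist x y ≤ (n + 1 : ℕ) ↔ Γ.edist x y ≤ n ∨ ∃ z, Γ.Adj x z ∧ Γ.edist z y ≤ n := by
  constructor
  · intro h
    obtain ⟨p, hp⟩ := SimpleGraph.exists_walk_of_edist_ne_top (ne_top_of_le_ne_top (by simp) h)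
    rw [← hp, Nat.cast_le] at h
    cases p with
    | nil => exact .inl (by simp)
    | cons hxz p =>
      exact .inr ⟨_, hxz, p.edist_le.trans (by exact_mod_cast Nat.le_of_succ_le_succ h)⟩
  · rintro (h | ⟨z, hxz, h⟩)
    · exact h.trans (by simp)
    · calc Γ.edist x y ≤ Γ.edist x z + Γ.edist z y := SimpleGraph.edist_triangle
        _ ≤ 1 + n := by gcongr; exact (SimpleGraph.edist_eq_one_iff_adj.2 hxz).le
        _ = (n + 1 : ℕ) := by rw [add_comm, Nat.cast_succ]

theorem exists_path_snd_eq {x y z : X} {n : ℕ} (hxy : ¬ Γ.edist x y ≤ n)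
    (hxz : Γ.Adj x z) (hzy : Γ.edist z y ≤ n) : ∃ p : Γ.Path x y, p.1.snd = z := by
  obtain ⟨q, hq⟩ := SimpleGraph.exists_walk_of_edist_ne_top (ne_top_of_le_ne_top (by simp) hzy)
  let p := SimpleGraph.Walk.cons hxz q
  rw [← p.reachable.coe_dist_eq_edist, Nat.cast_le, not_le] at hxy
  rw [← hq, Nat.cast_le] at hzy
  refine ⟨⟨p, p.isPath_of_length_eq_dist (le_antisymm ?_ (SimpleGraph.dist_le p))⟩, by simp [p]⟩
  exact (Nat.succ_le_succ hzy).trans hxy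

variable [MeasurableSpace X] [StandardBorelSpace X]

/-- By Lusin and Souslin: as paths are unique, a pair at distance `n + 1` determines the second
vertex of its geodesic. -/
theorem measurableSet_edist_le (hΓ : Γ.IsAcyclic)
    (hadj : MeasurableSet {p : X × X | Γ.Adj p.1 p.2}) (n : ℕ) :
    MeasurableSet {p : X × X | Γ.edist p.1 p.2 ≤ n} := by
  induction n with
  | zero =>
    simpa only [Nat.cast_zero, nonpos_iff_eq_zero, SimpleGraph.edist_eq_zero_iff] using
      measurableSet_eq_fun measurable_fst measurable_snd
  | succ n ih =>
    let T : Set ((X × X) × X) :=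
      {q | ¬ Γ.edist q.1.1 q.1.2 ≤ n ∧ Γ.Adj q.1.1 q.2 ∧ Γ.edist q.2 q.1.2 ≤ n}
    have hT : MeasurableSet T :=
      (measurable_fst ih.compl).inter
        (((measurable_fst.fst.prodMk measurable_snd) hadj).inter
          ((measurable_snd.prodMk measurable_fst.snd) ih))
    have hinj : T.InjOn Prod.fst := by
      rintro ⟨⟨x, y⟩, z⟩ ⟨hxy, hxz, hzy⟩ ⟨p, z'⟩ ⟨-, hxz', hzy'⟩ (rfl : (x, y) = p)
      obtain ⟨p, hp⟩ := exists_path_snd_eq hxy hxz hzy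
      obtain ⟨p', hp'⟩ := exists_path_snd_eq hxy hxz' hzy'
      rw [(hΓ.subsingleton_path x y).elim p p'] at hp
      exact Prod.ext rfl (hp.symm.trans hp')
    convert ih.union (hT.image_of_measurable_injOn measurable_fst hinj) using 1
    ext ⟨x, y⟩
    simp only [Set.mem_ofPred_eq, edist_le_succ_iff, Set.mem_union, Set.mem_image, Prod.exists, T]
    grind

theorem measurableSet_reachable_of_isAcyclic (hΓ : Γ.IsAcyclic)
    (hadj : MeasurableSet {p : X × X | Γ.Adj p.1 p.2}) :
    MeasurableSet {p : X × X | Γ.Reachable p.1 p.2} := by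
  convert MeasurableSet.iUnion (measurableSet_edist_le hΓ hadj) using 1
  ext p
  simp only [Set.mem_ofPred_eq, Set.mem_iUnion, ← SimpleGraph.edist_ne_top_iff_reachable]
  refine ⟨fun h => ?_, fun ⟨n, hn⟩ => ne_top_of_le_ne_top (ENat.natCast_ne_top n) hn⟩
  obtain ⟨n, hn⟩ := ENat.ne_top_iff_exists.1 h
  exact ⟨n, hn.ge⟩

end BorelAcyclic

theorem IsTreeable.measurableSet {X : Type*} [MeasurableSpace X] [StandardBorelSpace X]
    {R : Setoid X} (hR : IsTreeable R) : MeasurableSet {p : X × X | R p.1 p.2} := by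
  obtain ⟨Γ, hadj, hΓ, hreach⟩ := hR
  simpa only [hreach] using measurableSet_reachable_of_isAcyclic hΓ hadj

theorem IsCountableBorel.of_le {X : Type*} [MeasurableSpace X] {R S : Setoid X}
    (hR : IsCountableBorel R) (hS : MeasurableSet {p : X × X | S p.1 p.2}) (hSR : S ≤ R) :
    IsCountableBorel S :=
  ⟨hS, fun x => (hR.countable_class x).mono fun _ h => hSR h⟩

theorem measurableSet_inter_of_preimage_val {α : Type*} [MeasurableSpace α] {s t : Set α}
    (hs : MeasurableSet s) (ht : MeasurableSet (Subtype.val ⁻¹' t : Set s)) :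
    MeasurableSet (s ∩ t) :=
  Subtype.image_preimage_coe s t ▸ hs.subtype_image ht

theorem measurableSet_graph_of_measurable_domRestrict {α β : Type*} [MeasurableSpace α]
    [MeasurableSpace β] [MeasurableEq β] {s : Set α} (hs : MeasurableSet s)
    {f : α → β} (hf : Measurable (s.domRestrict f)) :
    MeasurableSet {p : α × β | p.1 ∈ s ∧ f p.1 = p.2} := by
  have hfst : Measurable fun q : (Prod.fst ⁻¹' s : Set (α × β)) => (⟨q.1.1, q.2⟩ : s) :=
    measurable_subtype_coe.fst.subtype_mk
  exact measurableSet_inter_of_preimage_val (measurable_fst hs)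
    (measurableSet_eq_fun (hf.comp hfst) measurable_subtype_coe.snd)

/-! ### Forests -/

namespace SerreGraph

variable {V E : Type*} (G : SerreGraph V E) {T : Set E}

/-- A forest is a graph without circuits, that is, without nonempty reduced closed walks. -/
def IsForest : Prop :=
  ∀ ⦃u : V⦄ ⦃l : List E⦄, G.IsWalk u l u → G.IsReduced l → l = []

/-- The simple graph spanned by the edges in `T`; orientations, loops and multiplicities are
forgotten. It makes the notions of connectedness and acyclicity of simple graphs available. -/
def toSimpleGraph (T : Set E) : SimpleGraph V :=
  SimpleGraph.fromRel fun u v => ∃ e ∈ T, G.org e = u ∧ G.ter e = v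

theorem ter_bar (e : E) : G.ter (G.bar e) = G.org e := by
  rw [← G.org_bar, G.bar_bar]

theorem bar_injective : Function.Injective G.bar :=
  Function.LeftInverse.injective G.bar_bar

theorem isWalk_append {u v : V} {l l' : List E} :
    G.IsWalk u (l ++ l') v ↔ ∃ w, G.IsWalk u l w ∧ G.IsWalk w l' v := by
  induction l generalizing u with
  | nil => simp [IsWalk]
  | cons e l ih => simp [IsWalk, ih, and_assoc]

variable {G}

theorem isReduced_cons {e : E} {l : List E} :
    G.IsReduced (e :: l) ↔ (∀ f ∈ l.head?, f ≠ G.bar e) ∧ G.IsReduced l :=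
  List.isChain_cons

theorem reachable_org_ter {e : E} (he : e ∈ T) :
    (G.toSimpleGraph T).Reachable (G.org e) (G.ter e) := by
  by_cases h : G.org e = G.ter e
  · rw [h]
  · exact ((SimpleGraph.fromRel_adj _ _ _).2 ⟨h, .inl ⟨e, he, rfl, rfl⟩⟩).reachable

theorem exists_org_eq_ter_eq_of_adj {u v : V} (h : (G.toSimpleGraph T).Adj u v) :
    ∃ e, G.org e = u ∧ G.ter e = v := by
  obtain ⟨-, ⟨e, -, rfl, rfl⟩ | ⟨e, -, rfl, rfl⟩⟩ := (SimpleGraph.fromRel_adj _ _ _).1 h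
  exacts [⟨e, rfl, rfl⟩, ⟨G.bar e, G.org_bar e, G.ter_bar e⟩]

section BarClosed

variable (hT : ∀ e ∈ T, G.bar e ∈ T)
include hT

theorem toSimpleGraph_adj_iff {u v : V} :
    (G.toSimpleGraph T).Adj u v ↔ u ≠ v ∧ ∃ e ∈ T, G.org e = u ∧ G.ter e = v := by
  rw [toSimpleGraph, SimpleGraph.fromRel_adj]
  refine and_congr_right fun _ => or_iff_left_of_imp ?_
  rintro ⟨e, he, rfl, rfl⟩
  exact ⟨G.bar e, hT e he, G.org_bar e, G.ter_bar e⟩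

theorem exists_isReduced_of_reachable {u v : V} (h : (G.toSimpleGraph T).Reachable u v) :
    ∃ l : List E, (∀ e ∈ l, e ∈ T) ∧ G.IsWalk u l v ∧ G.IsReduced l := by
  obtain ⟨p⟩ := h
  induction p with
  | nil => exact ⟨[], by simp, rfl, List.isChain_nil⟩
  | cons hadj _ ih =>
    obtain ⟨-, e, he, rfl, rfl⟩ := (toSimpleGraph_adj_iff hT).1 hadj
    obtain ⟨l, hl, hw, hr⟩ := ih
    cases l with
    | nil => exact ⟨[e], by simpa, ⟨rfl, hw⟩, List.isChain_singleton _⟩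
    | cons f l =>
      by_cases hf : f = G.bar e
      · refine ⟨l, fun g hg => hl g (by simp [hg]), ?_, hr.tail⟩
        rw [← G.ter_bar, ← hf]
        exact hw.2
      · refine ⟨e :: f :: l, ?_, ⟨rfl, hw⟩, List.isChain_cons_cons.2 ⟨hf, hr⟩⟩
        simpa [he] using hl

theorem isReduced_append {l l' : List E} (hl : G.IsReduced l) (hl' : G.IsReduced l')
    (hlT : ∀ e ∈ l, e ∈ T) (hl'T : ∀ e ∈ l'.head?, e ∉ T) : G.IsReduced (l ++ l') := by
  refine List.isChain_append.2 ⟨hl, hl', ?_⟩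
  rintro e he _ hf rfl
  exact hl'T _ hf (hT e (hlT e (List.mem_of_getLast? he)))

end BarClosed

theorem IsForest.isAcyclic_toSimpleGraph (hG : G.IsForest) (T : Set E) :
    (G.toSimpleGraph T).IsAcyclic := by
  refine SimpleGraph.isAcyclic_iff_forall_adj_isBridge.2 fun u v hadj => ?_
  rw [SimpleGraph.isBridge_iff]
  intro hreach
  obtain ⟨e, hu, hv⟩ := exists_org_eq_ter_eq_of_adj hadj.symm
  let S : Set E := {f | s(G.org f, G.ter f) ≠ s(u, v)}
  have hS : ∀ f ∈ S, G.bar f ∈ S := fun f hf => by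
    simpa only [S, Set.mem_ofPred_eq, G.org_bar, G.ter_bar, Sym2.eq_swap] using hf
  have hle : (G.toSimpleGraph T).deleteEdges {s(u, v)} ≤ G.toSimpleGraph S := by
    intro a b hab
    obtain ⟨hab, hne⟩ := SimpleGraph.deleteEdges_adj.1 hab
    obtain ⟨f, rfl, rfl⟩ := exists_org_eq_ter_eq_of_adj hab
    exact (toSimpleGraph_adj_iff hS).2 ⟨hab.ne, f, hne, rfl, rfl⟩
  obtain ⟨l, hlS, hwalk, hred⟩ := exists_isReduced_of_reachable hS (hreach.mono hle)
  have hhead : ∀ f ∈ l.head?, f ≠ G.bar e := by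
    rintro f hf rfl
    refine hlS _ (List.mem_of_head? hf) ?_
    rw [G.org_bar, G.ter_bar, hu, hv]
  exact List.cons_ne_nil e l
    (hG (u := v) ⟨hu, hv.symm ▸ hwalk⟩ (isReduced_cons.2 ⟨hhead, hred⟩))

theorem IsForest.eq_of_org_eq_of_ter_eq (hG : G.IsForest) {e f : E} (ho : G.org e = G.org f)
    (ht : G.ter e = G.ter f) : e = f := by
  by_contra hne
  have hred : G.IsReduced [e, G.bar f] :=
    List.isChain_cons_cons.2 ⟨fun h => hne (G.bar_injective h).symm, List.isChain_singleton _⟩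
  have hwalk : G.IsWalk (G.org e) [e, G.bar f] (G.org e) :=
    ⟨rfl, by rw [G.org_bar, ht], by rw [G.ter_bar]; exact ho.symm⟩
  exact List.cons_ne_nil _ _ (hG hwalk hred)

theorem IsForest.measurableSet_toSimpleGraph_adj [MeasurableSpace V] [StandardBorelSpace V]
    [MeasurableSpace E] [StandardBorelSpace E] (hG : G.IsForest) (ho : Measurable G.org)
    (ht : Measurable G.ter) (hT : MeasurableSet T) :
    MeasurableSet {p : V × V | (G.toSimpleGraph T).Adj p.1 p.2} := by
  have hinj : Function.Injective fun e => (G.org e, G.ter e) := fun e f h =>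
    hG.eq_of_org_eq_of_ter_eq (congrArg Prod.fst h) (congrArg Prod.snd h)
  have himage : MeasurableSet ((fun e => (G.org e, G.ter e)) '' T) :=
    hT.image_of_measurable_injOn (ho.prodMk ht) hinj.injOn
  refine measurableSet_fromRel_adj ?_
  convert (measurableSet_diagonal (α := V)).compl.inter himage using 1
  ext ⟨u, v⟩
  simp

theorem IsForest.measurableSet_toSimpleGraph_reachable [MeasurableSpace V] [StandardBorelSpace V]
    [MeasurableSpace E] [StandardBorelSpace E] (hG : G.IsForest) (ho : Measurable G.org)
    (ht : Measurable G.ter) (hT : MeasurableSet T) :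
    MeasurableSet {p : V × V | (G.toSimpleGraph T).Reachable p.1 p.2} :=
  measurableSet_reachable_of_isAcyclic (hG.isAcyclic_toSimpleGraph T)
    (hG.measurableSet_toSimpleGraph_adj ho ht hT)

end SerreGraph

/-! ### Actions -/

namespace FibredAction

variable {X F : Type*} [MeasurableSpace X] [MeasurableSpace F] {R : Setoid X}
  (A : FibredAction R F)

/-- The translate of `f` to the fibre over `x`, that is `(x, y) · f` where `y` is the projection
of `f`. It is meaningful only when `R x y`. -/
def translate (x : X) (f : F) : F :=
  A.act x (A.proj f) f

variable {A}

theorem proj_translate {x : X} {f : F} (h : R x (A.proj f)) : A.proj (A.translate x f) = x :=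
  A.proj_act _ _ _ h rfl

theorem translate_proj (f : F) : A.translate (A.proj f) f = f :=
  A.act_self _ _ rfl

theorem orbitRel_iff {f g : F} :
    A.orbitRel f g ↔ R (A.proj f) (A.proj g) ∧ A.translate (A.proj f) g = f :=
  Iff.rfl

theorem orbitRel_translate {x : X} {f : F} (h : R x (A.proj f)) :
    A.orbitRel (A.translate x f) f := by
  rw [orbitRel_iff, proj_translate h]
  exact ⟨h, rfl⟩

theorem translate_eq_of_orbitRel {x : X} {f g : F} (h : A.orbitRel f g) (hx : R x (A.proj f)) :
    A.translate x f = A.translate x g := by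
  have := (A.orbitRel.trans (orbitRel_translate hx) h).2
  rwa [proj_translate hx, eq_comm] at this

theorem measurable_translate :
    Measurable fun q : {q : X × F // R q.1 (A.proj q.2)} => A.translate q.1.1 q.1.2 := by
  have hmk : Measurable fun q : {q : X × F // R q.1 (A.proj q.2)} =>
      (⟨((q.1.1, A.proj q.1.2), q.1.2), q.2, rfl⟩ :
        {q : (X × X) × F // R q.1.1 q.1.2 ∧ A.proj q.2 = q.1.2}) := by
    have := A.measurable_proj
    exact Measurable.subtype_mk (by fun_prop)
  exact A.measurable_act.comp hmk

theorem measurableSet_orbitRel [MeasurableEq F] (hR : MeasurableSet {p : X × X | R p.1 p.2}) :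
    MeasurableSet {p : F × F | A.orbitRel p.1 p.2} := by
  have hp := A.measurable_proj
  have hS : MeasurableSet {p : F × F | R (A.proj p.1) (A.proj p.2)} :=
    (by fun_prop : Measurable fun p : F × F => (A.proj p.1, A.proj p.2)) hR
  have hmk : Measurable fun p : {p : F × F | R (A.proj p.1) (A.proj p.2)} =>
      (⟨(A.proj p.1.1, p.1.2), p.2⟩ : {q : X × F // R q.1 (A.proj q.2)}) :=
    Measurable.subtype_mk (by fun_prop)
  have htranslate : Measurable fun p : {p : F × F | R (A.proj p.1) (A.proj p.2)} =>
      A.translate (A.proj p.1.1) p.1.2 :=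
    A.measurable_translate.comp hmk
  exact measurableSet_inter_of_preimage_val hS
    (measurableSet_eq_fun htranslate measurable_subtype_coe.fst)

/-- A saturation and its complement are both projections of Borel sets. -/
theorem measurableSet_saturation [StandardBorelSpace F] {ι : Type*} [Countable ι]
    (hR : MeasurableSet {p : X × X | R p.1 p.2}) {B : ι → Set F} (hB : ∀ i, MeasurableSet (B i))
    (hcover : ⋃ i, A.saturation (B i) = Set.univ)
    (hdisjoint : Pairwise fun i j => Disjoint (A.saturation (B i)) (A.saturation (B j))) (i : ι) :
    MeasurableSet (A.saturation (B i)) := by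
  let S : Set (F × F) := {p | A.orbitRel p.1 p.2} ∩ Prod.snd ⁻¹' ⋃ i, B i
  have hS : MeasurableSet S :=
    (measurableSet_orbitRel hR).inter (measurable_snd (MeasurableSet.iUnion hB))
  have := hS.standardBorel
  have hsurj : Function.Surjective fun p : S => p.1.1 := by
    intro f
    obtain ⟨j, g, hg, hfg⟩ := Set.mem_iUnion.1 (hcover.ge (Set.mem_univ f))
    exact ⟨⟨(f, g), hfg, Set.mem_iUnion.2 ⟨j, hg⟩⟩, rfl⟩
  have hpreimage : (fun p : S => p.1.1) ⁻¹' A.saturation (B i) = {p : S | p.1.2 ∈ B i} := by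
    ext ⟨⟨f, g⟩, hfg, hg⟩
    refine ⟨fun hf => ?_, fun hg => ⟨g, hg, hfg⟩⟩
    obtain ⟨j, hg⟩ := Set.mem_iUnion.1 hg
    obtain rfl : i = j := by
      by_contra hij
      exact Set.disjoint_left.1 (hdisjoint hij) hf ⟨g, hg, hfg⟩
    exact hg
  refine (measurable_subtype_coe.fst.measurableSet_preimage_iff_of_surjective hsurj).1 ?_
  rw [hpreimage]
  exact measurable_subtype_coe.snd (hB i)

end FibredAction

namespace GraphField

variable {X V E : Type*} [MeasurableSpace X] [MeasurableSpace V] [MeasurableSpace E]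
  {R : Setoid X} {A : GraphField R V E}

theorem org_translate {x : X} {e : E} (h : R x (A.edge.proj e)) :
    A.org (A.edge.translate x e) = A.vert.translate x (A.org e) := by
  rw [FibredAction.translate, FibredAction.translate, A.org_act _ _ _ h rfl, A.proj_org]

theorem ter_translate {x : X} {e : E} (h : R x (A.edge.proj e)) :
    A.ter (A.edge.translate x e) = A.vert.translate x (A.ter e) := by
  rw [FibredAction.translate, FibredAction.translate, A.ter_act _ _ _ h rfl, A.proj_ter]

theorem orbitRel_bar {e f : E} (h : A.edge.orbitRel e f) :
    A.edge.orbitRel (A.bar e) (A.bar f) := by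
  obtain ⟨hR, hef⟩ := h
  refine ⟨by rwa [A.proj_bar, A.proj_bar], ?_⟩
  rw [A.proj_bar, A.proj_bar, ← A.bar_act _ _ _ hR rfl, hef]

theorem orbitRel_org {e f : E} (h : A.edge.orbitRel e f) :
    A.vert.orbitRel (A.org e) (A.org f) := by
  obtain ⟨hR, hef⟩ := h
  refine ⟨by rwa [A.proj_org, A.proj_org], ?_⟩
  rw [A.proj_org, A.proj_org, ← A.org_act _ _ _ hR rfl, hef]

theorem orbitRel_ter {e f : E} (h : A.edge.orbitRel e f) :
    A.vert.orbitRel (A.ter e) (A.ter f) := by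
  simpa only [A.org_bar] using orbitRel_org (orbitRel_bar h)

theorem proj_eq_of_isWalk {u v : V} {l : List E} (h : A.IsWalk u l v) :
    ∀ e ∈ l, A.edge.proj e = A.vert.proj u := by
  induction l generalizing u with
  | nil => simp
  | cons e l ih =>
    obtain ⟨rfl, h⟩ := h
    rintro f (- | ⟨_, hf⟩)
    · rw [A.proj_org]
    · rw [ih h f hf, A.proj_ter, A.proj_org]

theorem IsArboretum.isForest (hA : A.IsArboretum) : A.IsForest := fun u l h hl =>
  (hA (A.vert.proj u)).no_circuit u l (proj_eq_of_isWalk h) h hl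

end GraphField

/-! ### Desingularizations -/

namespace Desingularization

variable {X V E : Type*} [MeasurableSpace X] [MeasurableSpace V] [MeasurableSpace E]
  {R : Setoid X} {A : GraphField R V E} {G : RelGraph} (D : Desingularization A G)

/-- The representative over `x` of the root of the maximal subtree. -/
def rootPoint (x : X) : V :=
  D.χV ⟨D.root, D.base.symm x⟩

/-- The vertex `u` lies in a translate of the tree of representatives over `y`. -/
def Covers (y : X) (u : V) : Prop :=
  ∃ q, A.vert.proj (D.χV q) = y ∧ A.vert.orbitRel u (D.χV q)

/-- The edges of the translates of the arboretum of representatives. -/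
def treeEdges : Set E :=
  {ε | ∃ e : G.Edge × Bool, e.1 ∈ D.tree ∧ ε ∈ A.edge.saturation (D.edgeRep e)}

/-- The forest spanned by the translates of the arboretum of representatives; its components are
the translates of the trees of representatives. -/
def treeGraph : SimpleGraph V :=
  A.toSimpleGraph D.treeEdges

/-- The edge `e` is a translate of the edge of the section attached to the positive edge `a` over
`y`, and `φ a` sends `y` to `y'`. -/
def Crosses (a : G.Edge) (y y' : X) (e : E) : Prop :=
  ∃ (ha : a ∉ D.tree) (hy : y ∈ (D.φ a ha).source),
    (D.φ a ha).toFun y = y' ∧ A.edge.orbitRel e (D.sec a ha ⟨y, hy⟩)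

/-- The edge `e` leads from a translate of the tree of representatives over `y` to a translate of
the one over `y'`, along an edge outside the maximal subtree with either orientation. -/
def Joins (y y' : X) (e : E) : Prop :=
  ∃ a, D.Crosses a y y' e ∨ D.Crosses a y' y (A.bar e)

/-- The graph on `X` spanned by the partial isomorphisms `φ a`. -/
def edgeGraph : SimpleGraph X :=
  SimpleGraph.fromRel fun x y => ∃ a ha, x ∈ (D.φ a ha).source ∧ (D.φ a ha).toFun x = y

variable {D}

/-! ### The trees of representatives -/

theorem proj_eq_of_gluing {q q' : G.VTotal} (h : G.gluing D.tree q q') :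
    A.vert.proj (D.χV q) = A.vert.proj (D.χV q') := by
  obtain ⟨r, hr, -⟩ := D.rooted q
  rw [D.proj_χV q r hr, D.proj_χV q' r (Setoid.trans' _ (Setoid.symm' _ h) hr)]

theorem gluing_of_proj_eq {q q' : G.VTotal} (h : A.vert.proj (D.χV q) = A.vert.proj (D.χV q')) :
    G.gluing D.tree q q' := by
  obtain ⟨r, hr, -⟩ := D.rooted q
  obtain ⟨r', hr', -⟩ := D.rooted q'
  rw [D.proj_χV q r hr, D.proj_χV q' r' hr'] at h
  obtain rfl := D.base.injective h
  exact Setoid.trans' _ hr (Setoid.symm' _ hr')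

theorem proj_rootPoint (x : X) : A.vert.proj (D.rootPoint x) = x := by
  rw [rootPoint, D.proj_χV _ _ (Setoid.refl' _ _), MeasurableEquiv.apply_symm_apply]

theorem covers_proj_χV (q : G.VTotal) : D.Covers (A.vert.proj (D.χV q)) (D.χV q) :=
  ⟨q, rfl, Setoid.refl' _ _⟩

theorem covers_rootPoint (x : X) : D.Covers x (D.rootPoint x) :=
  ⟨_, proj_rootPoint x, Setoid.refl' _ _⟩

theorem Covers.rel {y : X} {u : V} (h : D.Covers y u) : R (A.vert.proj u) y := by
  obtain ⟨q, rfl, h⟩ := h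
  exact h.1

theorem Covers.of_orbitRel {y : X} {u v : V} (h : D.Covers y v) (huv : A.vert.orbitRel u v) :
    D.Covers y u := by
  obtain ⟨q, hq, h⟩ := h
  exact ⟨q, hq, Setoid.trans' _ huv h⟩

theorem Covers.translate {x y : X} {u : V} (h : D.Covers y u) (hx : R x (A.vert.proj u)) :
    D.Covers y (A.vert.translate x u) :=
  h.of_orbitRel (FibredAction.orbitRel_translate hx)

/-! ### The edges of the arboretum -/

theorem bar_mem_edgeRep {e : G.Edge × Bool} {ε : E} (h : ε ∈ D.edgeRep e) :
    A.bar ε ∈ D.edgeRep (e.1, !e.2) := by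
  obtain ⟨a, b⟩ := e
  obtain ⟨h, w, rfl⟩ | ⟨h, x, rfl⟩ := h
  · exact .inl ⟨h, w, D.χ_bar _⟩
  · refine .inr ⟨h, x, ?_⟩
    cases b <;> simp [A.bar_bar]

theorem bar_mem_saturation {e : G.Edge × Bool} {ε : E}
    (h : ε ∈ A.edge.saturation (D.edgeRep e)) :
    A.bar ε ∈ A.edge.saturation (D.edgeRep (e.1, !e.2)) := by
  obtain ⟨g, hg, h⟩ := h
  exact ⟨_, bar_mem_edgeRep hg, GraphField.orbitRel_bar h⟩

theorem eq_of_mem_saturation {e e' : G.Edge × Bool} {ε : E}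
    (h : ε ∈ A.edge.saturation (D.edgeRep e)) (h' : ε ∈ A.edge.saturation (D.edgeRep e')) :
    e = e' := by
  by_contra hne
  exact Set.disjoint_left.1 (D.edge_disjoint hne) h h'

theorem bar_mem_treeEdges (e : E) (h : e ∈ D.treeEdges) : A.bar e ∈ D.treeEdges := by
  obtain ⟨⟨a, b⟩, ha, h⟩ := h
  exact ⟨(a, !b), ha, bar_mem_saturation h⟩

theorem exists_covers_of_mem_treeEdges {e : E} (h : e ∈ D.treeEdges) :
    ∃ y, D.Covers y (A.org e) ∧ D.Covers y (A.ter e) := by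
  obtain ⟨⟨a, b⟩, ha, ε, ⟨ht, w, rfl⟩ | ⟨ht, -⟩, h⟩ := h
  · let ε := D.χE (⟨⟨a, ht⟩, w⟩, b)
    have ho : D.Covers (A.edge.proj ε) (A.org ε) := by
      rw [← A.proj_org, D.χ_org]
      exact covers_proj_χV _
    have ht : D.Covers (A.edge.proj ε) (A.ter ε) := by
      rw [← A.proj_ter, D.χ_ter]
      exact covers_proj_χV _
    exact ⟨_, ho.of_orbitRel (GraphField.orbitRel_org h),
      ht.of_orbitRel (GraphField.orbitRel_ter h)⟩
  · exact absurd ha ht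

section Crosses

variable {a b : G.Edge} {y y' z : X} {e : E}

theorem Crosses.mem_saturation (h : D.Crosses a y y' e) :
    e ∈ A.edge.saturation (D.edgeRep (a, true)) := by
  obtain ⟨ha, hy, -, h⟩ := h
  exact ⟨_, .inr ⟨ha, _, rfl⟩, h⟩

theorem Crosses.edge_eq {z z' : X} (h : D.Crosses a y y' e) (h' : D.Crosses b z z' e) : a = b :=
  congrArg Prod.fst (eq_of_mem_saturation h.mem_saturation h'.mem_saturation)

theorem Crosses.not_crosses_bar {z z' : X} (h : D.Crosses a y y' e) :
    ¬ D.Crosses b z z' (A.bar e) := fun h' =>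
  Bool.false_ne_true <| congrArg Prod.snd <|
    eq_of_mem_saturation (bar_mem_saturation h.mem_saturation) h'.mem_saturation

theorem Crosses.notMem_treeEdges (h : D.Crosses a y y' e) : e ∉ D.treeEdges := by
  rintro ⟨b, hb, he⟩
  obtain rfl := eq_of_mem_saturation he h.mem_saturation
  exact h.1 hb

theorem Crosses.covers_org (h : D.Crosses a y y' e) : D.Covers y (A.org e) := by
  obtain ⟨ha, hy, rfl, h⟩ := h
  obtain ⟨q, hq⟩ := D.org_sec_mem a ha ⟨y, hy⟩
  have hsec := covers_proj_χV (D := D) ⟨_, q⟩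
  rw [show D.χV _ = _ from hq, A.proj_org, D.proj_sec] at hsec
  exact hsec.of_orbitRel (GraphField.orbitRel_org h)

theorem Crosses.covers_ter (h : D.Crosses a y y' e) : D.Covers y' (A.ter e) := by
  obtain ⟨ha, hy, rfl, h⟩ := h
  have hR : R ((D.φ a ha).toFun y) (A.vert.proj (A.ter (D.sec a ha ⟨y, hy⟩))) := by
    rw [A.proj_ter, D.proj_sec]
    exact Setoid.symm' _ ((D.φ a ha).rel y hy)
  have hmoved : D.movedTer a ha ⟨(D.φ a ha).toFun y, (D.φ a ha).map_source' hy⟩ =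
      A.vert.translate ((D.φ a ha).toFun y) (A.ter (D.sec a ha ⟨y, hy⟩)) := by
    have hinv : D.inv a ha ⟨(D.φ a ha).toFun y, (D.φ a ha).map_source' hy⟩ = ⟨y, hy⟩ :=
      Subtype.ext ((D.φ a ha).left_inv' hy)
    rw [DesingularizationData.movedTer, hinv, FibredAction.translate, A.proj_ter, D.proj_sec]
  obtain ⟨q, hq⟩ := D.ter_sec_mem a ha ⟨(D.φ a ha).toFun y, (D.φ a ha).map_source' hy⟩
  have hsec := covers_proj_χV (D := D) ⟨_, q⟩
  rw [show D.χV _ = _ from hq, hmoved, FibredAction.proj_translate hR] at hsec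
  exact (hsec.of_orbitRel (Setoid.symm' _ (FibredAction.orbitRel_translate hR))).of_orbitRel
    (GraphField.orbitRel_ter h)

theorem exists_crosses {ha : a ∉ D.tree} (hy : y ∈ (D.φ a ha).source) (hz : R z y) :
    ∃ e, A.edge.proj e = z ∧ D.Crosses a y ((D.φ a ha).toFun y) e := by
  have hR : R z (A.edge.proj (D.sec a ha ⟨y, hy⟩)) := by rwa [D.proj_sec]
  exact ⟨_, FibredAction.proj_translate hR, ha, hy, rfl, FibredAction.orbitRel_translate hR⟩

end Crosses

section Joins

variable {y y' x x' z : X} {e : E}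

theorem Joins.symm (h : D.Joins y y' e) : D.Joins y' y (A.bar e) := by
  obtain ⟨a, h | h⟩ := h
  · exact ⟨a, .inr (by rwa [A.bar_bar])⟩
  · exact ⟨a, .inl h⟩

theorem Joins.covers_org (h : D.Joins y y' e) : D.Covers y (A.org e) := by
  obtain ⟨a, h | h⟩ := h
  · exact h.covers_org
  · simpa only [A.ter_bar] using h.covers_ter

theorem Joins.covers_ter (h : D.Joins y y' e) : D.Covers y' (A.ter e) := by
  simpa only [A.org_bar] using h.symm.covers_org

theorem Joins.notMem_treeEdges (h : D.Joins y y' e) : e ∉ D.treeEdges := by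
  obtain ⟨a, h | h⟩ := h
  · exact h.notMem_treeEdges
  · exact fun he => h.notMem_treeEdges (bar_mem_treeEdges e he)

theorem Joins.right_unique (h : D.Joins y x e) (h' : D.Joins y x' e) : x = x' := by
  obtain ⟨a, h | h⟩ := h <;> obtain ⟨b, h' | h'⟩ := h'
  · obtain rfl := h.edge_eq h'
    obtain ⟨-, -, rfl, -⟩ := h
    exact h'.2.2.1
  · exact absurd h' h.not_crosses_bar
  · exact absurd h h'.not_crosses_bar
  · obtain rfl := h.edge_eq h'
    obtain ⟨ha, hx, hxy, -⟩ := h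
    obtain ⟨_, hx', hxy', -⟩ := h'
    exact (D.φ a ha).injOn hx hx' (hxy.trans hxy'.symm)

theorem exists_joins_of_notMem_treeEdges (h : e ∉ D.treeEdges) : ∃ y y', D.Joins y y' e := by
  obtain ⟨⟨a, b⟩, he⟩ := Set.mem_iUnion.1 (D.edge_cover.ge (Set.mem_univ e))
  have ha : a ∉ D.tree := fun ha => h ⟨_, ha, he⟩
  obtain ⟨ε, ⟨ha', -⟩ | ⟨_, y, rfl⟩, hε⟩ := he
  · exact absurd ha' ha
  · cases b
    · refine ⟨_, y, a, .inr ⟨ha, y.2, rfl, ?_⟩⟩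
      simpa only [Bool.false_eq_true, if_false, A.bar_bar] using GraphField.orbitRel_bar hε
    · exact ⟨y, _, a, .inl ⟨ha, y.2, rfl, hε⟩⟩

theorem exists_joins_of_adj (h : D.edgeGraph.Adj y y') (hz : R z y) :
    ∃ e, A.edge.proj e = z ∧ D.Joins y y' e := by
  obtain ⟨-, ⟨a, ha, hy, rfl⟩ | ⟨a, ha, hy, rfl⟩⟩ := (SimpleGraph.fromRel_adj _ _ _).1 h
  · obtain ⟨e, he, h⟩ := exists_crosses hy hz
    exact ⟨e, he, a, .inl h⟩
  · obtain ⟨e, he, h⟩ :=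
      exists_crosses hy (Setoid.trans' _ hz (Setoid.symm' _ ((D.φ a ha).rel _ hy)))
    exact ⟨A.bar e, by rwa [A.proj_bar], a, .inr (by rwa [A.bar_bar])⟩

theorem Joins.edgePart (h : D.Joins y y' e) : D.edgePart y y' := by
  obtain ⟨a, ⟨ha, hy, h, -⟩ | ⟨ha, hy, h, -⟩⟩ := h
  · exact .rel _ _ ⟨(a, true), .inr ⟨ha, hy, h⟩⟩
  · exact .symm _ _ (.rel _ _ ⟨(a, true), .inr ⟨ha, hy, h⟩⟩)

end Joins

/-! ### The components of the forest of translates -/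

theorem reachable_translate_of_gluing {z : X} {q q' : G.VTotal} (h : G.gluing D.tree q q')
    (hz : R z (A.vert.proj (D.χV q))) :
    D.treeGraph.Reachable (A.vert.translate z (D.χV q)) (A.vert.translate z (D.χV q')) := by
  change Relation.EqvGen _ q q' at h
  induction h with
  | refl => exact .rfl
  | symm q q' h ih => exact (ih (proj_eq_of_gluing h ▸ hz)).symm
  | trans q q' q'' h _ ih ih' => exact (ih hz).trans (ih' (proj_eq_of_gluing h ▸ hz))
  | rel q q' h =>
    obtain ⟨w, rfl, rfl⟩ := h
    have horg : A.org (D.χE (w, true)) = D.χV ⟨G.org w.1, G.injO w.1 w.2⟩ := D.χ_org _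
    have hter : A.ter (D.χE (w, true)) = D.χV ⟨G.ter w.1, G.injT w.1 w.2⟩ := D.χ_ter _
    rw [← horg, A.proj_org] at hz
    have hmem : A.edge.translate z (D.χE (w, true)) ∈ D.treeEdges :=
      ⟨(w.1, true), w.1.2, _, .inl ⟨w.1.2, w.2, rfl⟩, FibredAction.orbitRel_translate hz⟩
    rw [← horg, ← hter, ← GraphField.org_translate hz, ← GraphField.ter_translate hz]
    exact SerreGraph.reachable_org_ter hmem

theorem Covers.reachable {y : X} {u v : V} (hu : D.Covers y u) (hv : D.Covers y v)
    (huv : A.vert.proj u = A.vert.proj v) : D.treeGraph.Reachable u v := by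
  obtain ⟨q, rfl, hu⟩ := hu
  obtain ⟨q', hq, hv⟩ := hv
  rw [← hu.2, ← hv.2, ← huv, hq]
  simpa only [FibredAction.translate, hq] using
    reachable_translate_of_gluing (gluing_of_proj_eq hq.symm) hu.1

theorem Covers.vertexPart {y y' : X} {u : V} (h : D.Covers y u) (h' : D.Covers y' u) :
    D.vertexPart y y' := by
  obtain ⟨⟨P, q⟩, rfl, h⟩ := h
  obtain ⟨⟨P', q'⟩, rfl, h'⟩ := h'
  obtain rfl : P = P' := by
    by_contra hne
    exact Set.disjoint_left.1 (D.vertex_disjoint hne) ⟨_, ⟨q, rfl⟩, h⟩ ⟨_, ⟨q', rfl⟩, h'⟩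
  have hq : A.vert.orbitRel (D.χV ⟨P, q⟩) (D.χV ⟨P, q'⟩) := Setoid.trans' _ (Setoid.symm' _ h) h'
  exact .rel _ _ ⟨P, q, q', (D.vRel_iff _ _ _).2 hq, rfl, rfl⟩

theorem vertexPart_of_reachable {u v : V} (h : D.treeGraph.Reachable u v) {x y : X}
    (hu : D.Covers x u) (hv : D.Covers y v) : D.vertexPart x y := by
  obtain ⟨p⟩ := h
  induction p generalizing x with
  | nil => exact hu.vertexPart hv
  | cons hadj _ ih =>
    obtain ⟨-, e, he, rfl, rfl⟩ := (SerreGraph.toSimpleGraph_adj_iff bar_mem_treeEdges).1 hadj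
    obtain ⟨z, hz, hz'⟩ := exists_covers_of_mem_treeEdges he
    exact Setoid.trans' _ (hu.vertexPart hz) (ih hz' hv)

theorem vertexPart_le : D.vertexPart ≤ R := by
  refine Setoid.eqvGen_le ?_
  rintro x y ⟨P, q, q', h, rfl, rfl⟩
  exact ((D.vRel_iff _ _ _).1 h).1

theorem Covers.reachable_translate {y z : X} {u : V} (h : D.Covers y u)
    (hz : R z (A.vert.proj u)) :
    D.treeGraph.Reachable (A.vert.translate z (D.rootPoint y)) (A.vert.translate z u) := by
  have hz' : R z (A.vert.proj (D.rootPoint y)) := by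
    rw [proj_rootPoint]
    exact Setoid.trans' _ hz h.rel
  exact ((covers_rootPoint y).translate hz').reachable (h.translate hz)
    ((FibredAction.proj_translate hz').trans (FibredAction.proj_translate hz).symm)

theorem reachable_of_vertexPart {x y z : X} (h : D.vertexPart x y) (hz : R z x) :
    D.treeGraph.Reachable (A.vert.translate z (D.rootPoint x))
      (A.vert.translate z (D.rootPoint y)) := by
  change Relation.EqvGen _ x y at h
  induction h with
  | refl => exact .rfl
  | symm x y h ih => exact (ih (Setoid.trans' _ hz (Setoid.symm' _ (vertexPart_le h)))).symm
  | trans x y w h _ ih ih' =>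
    exact (ih hz).trans (ih' (Setoid.trans' _ hz (vertexPart_le h)))
  | rel x y h =>
    obtain ⟨P, q, q', h, rfl, rfl⟩ := h
    have ho := (D.vRel_iff _ _ _).1 h
    have hq := (covers_proj_χV ⟨P, q⟩).reachable_translate hz
    have hq' := (covers_proj_χV ⟨P, q'⟩).reachable_translate (Setoid.trans' _ hz ho.1)
    rw [FibredAction.translate_eq_of_orbitRel ho hz] at hq
    exact hq.trans hq'.symm

theorem Covers.vertexPart_iff_reachable {x y : X} {u v : V} (hu : D.Covers x u)
    (hv : D.Covers y v) (huv : A.vert.proj u = A.vert.proj v) :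
    D.vertexPart x y ↔ D.treeGraph.Reachable u v := by
  refine ⟨fun h => ?_, fun h => vertexPart_of_reachable h hu hv⟩
  have hu' := hu.reachable_translate (Setoid.refl' R _)
  have hv' := hv.reachable_translate (Setoid.refl' R _)
  rw [FibredAction.translate_proj] at hu' hv'
  rw [← huv] at hv'
  exact hu'.symm.trans ((reachable_of_vertexPart h hu.rel).trans hv')

/-! ### Walks in the arboretum and in the graph of the partial isomorphisms -/

theorem edgePart_eq_eqvGen : D.edgePart = Relation.EqvGen.setoid fun x y =>
    ∃ a ha, x ∈ (D.φ a ha).source ∧ (D.φ a ha).toFun x = y := by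
  refine le_antisymm (Setoid.eqvGen_le ?_) (Setoid.eqvGen_le ?_)
  · rintro x y ⟨⟨a, b⟩, ⟨-, rfl, -⟩ | ⟨ha, h⟩⟩
    · exact Setoid.refl' _ _
    · cases b
      · obtain ⟨hx, rfl⟩ := h
        exact .symm _ _ (.rel _ _ ⟨a, ha, (D.φ a ha).map_target' hx, (D.φ a ha).right_inv' hx⟩)
      · exact .rel _ _ ⟨a, ha, h⟩
  · rintro x y ⟨a, ha, h⟩
    exact .rel _ _ ⟨(a, true), .inr ⟨ha, h⟩⟩

theorem edgePart_le : D.edgePart ≤ R := by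
  rw [edgePart_eq_eqvGen]
  refine Setoid.eqvGen_le ?_
  rintro x _ ⟨a, ha, hx, rfl⟩
  exact (D.φ a ha).rel x hx

theorem edgePart_iff_reachable {x y : X} : D.edgePart x y ↔ D.edgeGraph.Reachable x y := by
  rw [edgePart_eq_eqvGen, eqvGen_setoid_eq_reachableSetoid_fromRel]
  rfl

theorem sup_of_isWalk {u v : V} {l : List E} (h : A.IsWalk u l v) {x y : X} (hu : D.Covers x u)
    (hv : D.Covers y v) : (D.vertexPart ⊔ D.edgePart) x y := by
  have hvertex : D.vertexPart ≤ D.vertexPart ⊔ D.edgePart := le_sup_left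
  have hedge : D.edgePart ≤ D.vertexPart ⊔ D.edgePart := le_sup_right
  induction l generalizing x u with
  | nil =>
    obtain rfl : u = v := h
    exact hvertex (hu.vertexPart hv)
  | cons e l ih =>
    obtain ⟨rfl, h⟩ := h
    by_cases he : e ∈ D.treeEdges
    · obtain ⟨z, hz, hz'⟩ := exists_covers_of_mem_treeEdges he
      exact Setoid.trans' _ (hvertex (hu.vertexPart hz)) (ih h hz')
    · obtain ⟨z, z', hz⟩ := exists_joins_of_notMem_treeEdges he
      exact Setoid.trans' _ (hvertex (hu.vertexPart hz.covers_org))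
        (Setoid.trans' _ (hedge hz.edgePart) (ih h hz.covers_ter))

theorem eq_vertexPart_sup_edgePart (hA : A.IsArboretum) : R = D.vertexPart ⊔ D.edgePart := by
  refine le_antisymm (fun {x y} h => ?_) (sup_le vertexPart_le edgePart_le)
  have hy : R x (A.vert.proj (D.rootPoint y)) := by rwa [proj_rootPoint]
  obtain ⟨l, -, hl⟩ := (hA x).connected (D.rootPoint x) (proj_rootPoint x)
    (A.vert.translate x (D.rootPoint y)) (FibredAction.proj_translate hy)
  exact sup_of_isWalk hl (covers_rootPoint x) ((covers_rootPoint y).translate hy)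

/-- Between the lifts of two consecutive edges of the trail the walk stays in a component of the
forest of translates; it does not backtrack there because the trail does not. -/
theorem exists_isReduced_lift {x y : X} {w : V} (p : D.edgeGraph.Walk x y) (hp : p.IsTrail)
    (hw : D.Covers y w) :
    ∃ u l, D.Covers x u ∧ A.vert.proj u = A.vert.proj w ∧ A.IsWalk u l w ∧ A.IsReduced l ∧
      p.length ≤ l.length ∧ ∀ f ∈ l.head?, ∃ x', D.Joins x x' f ∧ s(x, x') ∈ p.edges := by
  induction p with
  | nil => exact ⟨w, [], hw, rfl, rfl, List.isChain_nil, le_rfl, by simp⟩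
  | @cons x x₁ y hadj p ih =>
    rw [SimpleGraph.Walk.isTrail_cons] at hp
    obtain ⟨u, l, hu, huw, hwalk, hred, hlen, hhead⟩ := ih hp.1 hw
    have hR : R (A.vert.proj u) x := Setoid.trans' _ hu.rel
      (edgePart_le (edgePart_iff_reachable.2 hadj.symm.reachable))
    obtain ⟨e, he, hjoin⟩ := exists_joins_of_adj hadj hR
    obtain ⟨q, hqT, hq, hqred⟩ := SerreGraph.exists_isReduced_of_reachable bar_mem_treeEdges
      (hjoin.covers_ter.reachable hu (by rw [A.proj_ter, he]))
    have hlT : ∀ f ∈ l.head?, f ∉ D.treeEdges := fun f hf => by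
      obtain ⟨x', hx', -⟩ := hhead f hf
      exact hx'.notMem_treeEdges
    have hback : ∀ f ∈ (q ++ l).head?, f ≠ A.bar e := by
      rintro _ hf rfl
      cases q with
      | cons g q =>
        obtain rfl : g = A.bar e := by simpa using hf
        exact hjoin.symm.notMem_treeEdges (hqT _ (by simp))
      | nil =>
        obtain ⟨x', hx', hmem⟩ := hhead _ hf
        obtain rfl := hjoin.symm.right_unique hx'
        exact hp.2 (Sym2.eq_swap ▸ hmem)
    refine ⟨A.org e, e :: (q ++ l), hjoin.covers_org, ?_,
      ⟨rfl, A.isWalk_append.2 ⟨u, hq, hwalk⟩⟩, SerreGraph.isReduced_cons.2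
        ⟨hback, SerreGraph.isReduced_append bar_mem_treeEdges hqred hred hqT hlT⟩, ?_, ?_⟩
    · rw [A.proj_org, he, huw]
    · simp only [SimpleGraph.Walk.length_cons, List.length_cons, List.length_append]
      omega
    · rintro f hf
      obtain rfl : e = f := by simpa using hf
      exact ⟨x₁, hjoin, by simp⟩

theorem nil_of_isTrail_of_vertexPart (hA : A.IsForest) {x y : X} (p : D.edgeGraph.Walk x y)
    (hp : p.IsTrail) (h : D.vertexPart x y) : p.Nil := by
  obtain ⟨u, l, hu, huw, hwalk, hred, hlen, hhead⟩ :=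
    exists_isReduced_lift p hp (covers_rootPoint y)
  obtain ⟨q, hqT, hq, hqred⟩ := SerreGraph.exists_isReduced_of_reachable bar_mem_treeEdges
    ((hu.vertexPart_iff_reachable (covers_rootPoint y) huw).1 h).symm
  have hlT : ∀ f ∈ l.head?, f ∉ D.treeEdges := fun f hf => by
    obtain ⟨x', hx', -⟩ := hhead f hf
    exact hx'.notMem_treeEdges
  have hnil : q ++ l = [] := hA (A.isWalk_append.2 ⟨u, hq, hwalk⟩)
    (SerreGraph.isReduced_append bar_mem_treeEdges hqred hred hqT hlT)
  rw [(List.append_eq_nil_iff.1 hnil).2, List.length_nil, Nat.le_zero] at hlen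
  exact SimpleGraph.Walk.length_eq_zero_iff.1 hlen

theorem isAcyclic_edgeGraph (hA : A.IsForest) : D.edgeGraph.IsAcyclic := fun _ p hp =>
  hp.not_nil (nil_of_isTrail_of_vertexPart hA p hp.isTrail (Setoid.refl' _ _))

theorem eq_of_vertexPart_of_edgePart (hA : A.IsForest) {x y : X} (h : D.vertexPart x y)
    (h' : D.edgePart x y) : x = y := by
  obtain ⟨p, hp⟩ := (edgePart_iff_reachable.1 h').exists_isPath
  exact (nil_of_isTrail_of_vertexPart hA p hp.isTrail h).eq

/-! ### Measurability -/

theorem measurable_rootPoint : Measurable D.rootPoint :=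
  D.measurable_χV.comp ((Measurable.of_le_map (iInf_le _ D.root)).comp D.base.symm.measurable)

theorem measurableSet_edgeGraph_adj [StandardBorelSpace X] :
    MeasurableSet {p : X × X | D.edgeGraph.Adj p.1 p.2} := by
  have hgraphs : MeasurableSet
      {p : X × X | ∃ a ha, p.1 ∈ (D.φ a ha).source ∧ (D.φ a ha).toFun p.1 = p.2} := by
    simp only [Set.ofPred_exists]
    exact .iUnion fun a => .iUnion fun ha => measurableSet_graph_of_measurable_domRestrict
      (D.φ a ha).measurableSet_source (D.φ a ha).measurable_toFun
  exact measurableSet_fromRel_adj (measurableSet_diagonal.compl.inter hgraphs)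

theorem isTreeable_edgePart [StandardBorelSpace X] (hA : A.IsForest) : IsTreeable D.edgePart :=
  ⟨D.edgeGraph, measurableSet_edgeGraph_adj, isAcyclic_edgeGraph hA,
    fun _ _ => edgePart_iff_reachable⟩

theorem isCountableBorel_edgePart [StandardBorelSpace X] (hR : IsCountableBorel R)
    (hA : A.IsForest) : IsCountableBorel D.edgePart :=
  hR.of_le (isTreeable_edgePart hA).measurableSet edgePart_le

theorem measurableSet_edgeRep [StandardBorelSpace X] [StandardBorelSpace E]
    (e : G.Edge × Bool) : MeasurableSet (D.edgeRep e) := by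
  obtain ⟨a, b⟩ := e
  by_cases ha : a ∈ D.tree
  · have hmeas : Measurable fun w : G.ESp a => D.χE (⟨⟨a, ha⟩, w⟩, b) :=
      D.measurable_χE.comp
        ((Measurable.of_le_map (iInf_le _ (⟨a, ha⟩ : D.tree))).prodMk measurable_const)
    have hinj : Function.Injective fun w : G.ESp a => D.χE (⟨⟨a, ha⟩, w⟩, b) := fun w w' h => by
      simpa using D.injective_χE h
    convert (hmeas.measurableEmbedding hinj).measurableSet_range using 1
    ext ε
    simp [DesingularizationData.edgeRep, ha, eq_comm]
  · have := (D.φ a ha).measurableSet_source.standardBorel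
    let s : (D.φ a ha).source → E := fun x => if b then D.sec a ha x else A.bar (D.sec a ha x)
    have hmeas : Measurable s := by
      cases b
      exacts [A.measurable_bar.comp (D.measurable_sec a ha), D.measurable_sec a ha]
    have hproj : ∀ x, A.edge.proj (s x) = x := fun x => by
      cases b <;> simp [s, A.proj_bar, D.proj_sec]
    have hinj : Function.Injective s := fun x y h =>
      Subtype.ext (by rw [← hproj x, ← hproj y, h])
    convert (hmeas.measurableEmbedding hinj).measurableSet_range using 1
    ext ε
    simp [DesingularizationData.edgeRep, ha, s, eq_comm]

theorem measurableSet_treeEdges [StandardBorelSpace X] [StandardBorelSpace E]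
    (hR : MeasurableSet {p : X × X | R p.1 p.2}) : MeasurableSet D.treeEdges := by
  have : D.treeEdges = ⋃ (e : G.Edge × Bool) (_ : e.1 ∈ D.tree),
      A.edge.saturation (D.edgeRep e) := by
    ext ε
    simp [treeEdges]
  rw [this]
  exact .iUnion fun e => .iUnion fun _ => FibredAction.measurableSet_saturation hR
    measurableSet_edgeRep D.edge_cover D.edge_disjoint e

variable [StandardBorelSpace X] [StandardBorelSpace V] [StandardBorelSpace E]

theorem measurableSet_vertexPart (hR : MeasurableSet {p : X × X | R p.1 p.2})
    (hA : A.IsForest) : MeasurableSet {p : X × X | D.vertexPart p.1 p.2} := by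
  have hroot := D.measurable_rootPoint
  have hmk : Measurable fun p : {p : X × X | R p.1 p.2} =>
      (⟨(p.1.1, D.rootPoint p.1.2), by rw [proj_rootPoint]; exact p.2⟩ :
        {q : X × V // R q.1 (A.vert.proj q.2)}) :=
    Measurable.subtype_mk (by fun_prop)
  have hpair : Measurable fun p : {p : X × X | R p.1 p.2} =>
      (D.rootPoint p.1.1, A.vert.translate p.1.1 (D.rootPoint p.1.2)) :=
    (by fun_prop : Measurable fun p : {p : X × X | R p.1 p.2} => D.rootPoint p.1.1).prodMk
      (A.vert.measurable_translate.comp hmk)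
  have hreach : MeasurableSet {p : V × V | D.treeGraph.Reachable p.1 p.2} :=
    hA.measurableSet_toSimpleGraph_reachable A.measurable_org A.measurable_ter
      (measurableSet_treeEdges hR)
  convert measurableSet_inter_of_preimage_val hR (t := {p : X × X | D.vertexPart p.1 p.2}) ?_
  · ext p
    exact (and_iff_right_of_imp fun h => vertexPart_le h).symm
  · convert hpair hreach using 1
    ext ⟨⟨x, y⟩, hxy⟩
    have hy : R x (A.vert.proj (D.rootPoint y)) := by
      rw [proj_rootPoint]
      exact hxy
    exact (covers_rootPoint x).vertexPart_iff_reachable ((covers_rootPoint y).translate hy)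
      ((proj_rootPoint x).trans (FibredAction.proj_translate hy).symm)

theorem isCountableBorel_vertexPart (hR : IsCountableBorel R) (hA : A.IsForest) :
    IsCountableBorel D.vertexPart :=
  hR.of_le (measurableSet_vertexPart hR.measurableSet hA) vertexPart_le

end Desingularization

theorem proposition40 {X V E : Type*}
    [MeasurableSpace X] [StandardBorelSpace X]
    [MeasurableSpace V] [StandardBorelSpace V]
    [MeasurableSpace E] [StandardBorelSpace E]
    (R : Setoid X) (hR : IsCountableBorel R)
    (A : GraphField R V E) (hA : A.IsArboretum)
    (G : RelGraph) (D : Desingularization A G) :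
    IsCountableBorel D.vertexPart ∧ IsCountableBorel D.edgePart ∧
      R = D.vertexPart ⊔ D.edgePart ∧
      IsTreeable D.edgePart ∧
      ∀ P x y, D.vertexRel P x y → D.edgePart x y → x = y :=
  ⟨D.isCountableBorel_vertexPart hR hA.isForest, D.isCountableBorel_edgePart hR hA.isForest,
    D.eq_vertexPart_sup_edgePart hA, D.isTreeable_edgePart hA.isForest, fun P _ _ h h' =>
      D.eq_of_vertexPart_of_edgePart hA.isForest (.rel _ _ ⟨P, h⟩) h'⟩
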